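/- Let $(X,\mathcal A,m)$ be a measure space (for example a Hausdorff topological space with a $\sigma$-finite Radon measure of full support), and let $L^2=L^2(X,m)$ be the real $L^2$-space with scalar product $(\cdot,\cdot)$. Let $\mathcal E$ with domain $\mathcal D\subset L^2$ be a (symmetric) Dirichlet form: a densely defined, closed, nonnegative symmetric quadratic form such that $u\in\mathcal D$ implies $u_{0,1}:=\min(\max(u,0),1)\in\mathcal D$ and $\mathcal E[u_{0,1}]\le\mathcal E[u]$. With a densely defined closed nonnegative symmetric form on $L^2$ we associate its nonnegative selfadjoint operator $L$ ($u\in\mathrm{dom}(L)$ and $Lu=w$ if and only if $u$ is in the domain of the form and its symmetric bilinear form satisfies $\mathcal E(u,v)=(w,v)$ for all $v$ in the domain), its semigroup $T_t=e^{-tL}$, $t>0$, and its resolvent $K_\beta=(L+\beta)^{-1}$, $\beta>0$. A set $Y\subset X$ is called invariant for the form if it is measurable and $T_t(1_Yu)=1_YT_tu$ for all $u\in L^2$ and all $t>0$. For $t>0$ and $\beta>0$ let $\mathcal E^{(t)}$ and $\mathcal E^{(\beta)}$ be the forms with domain $L^2$ given by $$\mathcal E^{(t)}[u]=\tfrac1t\,(u-T_tu,u),\qquad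 \mathcal E^{(\beta)}[u]=\beta\,(u-\beta K_\beta u,u),\qquad u\in L^2,$$ where $(T_t)$ and $(K_\beta)$ are the semigroup and the resolvent of $\mathcal E$. Theorem. For every measurable set $Y\subset X$ the following assertions are equivalent: (a) $Y$ is invariant for $\mathcal E^{(t)}$ for every $t>0$; (b) $Y$ is invariant for $\mathcal E^{(\beta)}$ for every $\beta>0$; (c) $Y$ is invariant for $\mathcal E$. -/

import Mathlib

open MeasureTheory Filter Topology

noncomputable section

/-- A (bilinear) form on a linear subspace of the real Hilbert space `L²(X, m)`; the laws that are
required of it are those of `L2Form.IsDirichletForm`. -/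
structure L2Form {X : Type*} [MeasurableSpace X] (m : Measure X) where
  /-- the domain of the form -/
  domain : Submodule ℝ (Lp ℝ 2 m)
  /-- the form, as a bilinear map on its domain; the quadratic form is `u ↦ form u u` -/
  form : LinearMap.BilinForm ℝ domain

/-- Multiplication of (the class of) a function `u ∈ L²(X, m)` by the indicator function `1_Y` of a
measurable set `Y`. -/
def indicatorMul {X : Type*} [MeasurableSpace X] {m : Measure X} {Y : Set X}
    (hY : MeasurableSet Y) (u : Lp ℝ 2 m) : Lp ℝ 2 m :=
  ((Lp.memLp u).indicator hY).toLp (Y.indicator u)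

namespace L2Form

variable {X : Type*} [MeasurableSpace X] {m : Measure X}

/-- A (symmetric) Dirichlet form: a densely defined, closed, nonnegative symmetric form on which
the unit contraction `u ↦ min (max u 0) 1` operates. -/
structure IsDirichletForm (E : L2Form m) : Prop where
  symm : ∀ u v : E.domain, E.form u v = E.form v u
  nonneg : ∀ u : E.domain, 0 ≤ E.form u u
  dense : Dense (E.domain : Set (Lp ℝ 2 m))
  /-- the domain is complete for the norm `(E[u] + ‖u‖²)^(1/2)` -/
  closed : ∀ u : ℕ → E.domain,
    (∀ ε : ℝ, 0 < ε → ∃ N : ℕ, ∀ j k : ℕ, N ≤ j → N ≤ k →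
      E.form (u j - u k) (u j - u k) + ‖u j - u k‖ ^ 2 < ε) →
    ∃ v : E.domain,
      Tendsto (fun k => E.form (u k - v) (u k - v) + ‖u k - v‖ ^ 2) atTop (𝓝 0)
  markov : ∀ u : E.domain, ∃ v : E.domain,
    ((v : Lp ℝ 2 m) : X → ℝ) =ᵐ[m] (fun x => min (max ((u : Lp ℝ 2 m) x) 0) 1) ∧
      E.form v v ≤ E.form u u

/-- `E.OperatorGraph u w` says that `u` is in the domain of the operator `L` associated with the
form `E` and that `L u = w`: namely, `u` is in the domain of `E` and `E(u, v) = (w, v)` for every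
`v` in the domain of `E`. -/
def OperatorGraph (E : L2Form m) (u w : Lp ℝ 2 m) : Prop :=
  ∃ hu : u ∈ E.domain, ∀ v : E.domain, E.form ⟨u, hu⟩ v = inner ℝ w (v : Lp ℝ 2 m)

/-- `T` is the strongly continuous semigroup `exp (-t L)`, `t ≥ 0`, whose generator is `-L`, where
`L` is the operator associated with the form `E`. Values of `T` at negative times are irrelevant. -/
structure IsSemigroup (E : L2Form m) (T : ℝ → Lp ℝ 2 m →L[ℝ] Lp ℝ 2 m) : Prop where
  zero : T 0 = ContinuousLinearMap.id ℝ (Lp ℝ 2 m)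
  add : ∀ s t : ℝ, 0 ≤ s → 0 ≤ t → T (s + t) = (T s).comp (T t)
  continuousOn : ∀ u : Lp ℝ 2 m, ContinuousOn (fun t => T t u) (Set.Ici 0)
  generator : ∀ u w : Lp ℝ 2 m,
    E.OperatorGraph u w ↔ Tendsto (fun t : ℝ => t⁻¹ • (u - T t u)) (𝓝[>] 0) (𝓝 w)

open Classical in
/-- The semigroup `(T_t)` related to `E`. It exists, and is unique on `t ≥ 0`, for every densely
defined closed nonnegative symmetric form. -/
def semigroup (E : L2Form m) : ℝ → Lp ℝ 2 m →L[ℝ] Lp ℝ 2 m :=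
  if h : ∃ T, E.IsSemigroup T then h.choose else 0

/-- `K` is the resolvent `(L + β)⁻¹` of the form `E`: for every `f ∈ L²` the function `K f` is the
element of the domain with `E(K f, v) + β (K f, v) = (f, v)` for every `v` in the domain. -/
def IsResolvent (E : L2Form m) (β : ℝ) (K : Lp ℝ 2 m →L[ℝ] Lp ℝ 2 m) : Prop :=
  ∀ f : Lp ℝ 2 m, ∃ hf : K f ∈ E.domain, ∀ v : E.domain,
    E.form ⟨K f, hf⟩ v + β * inner ℝ (K f) (v : Lp ℝ 2 m) = inner ℝ f (v : Lp ℝ 2 m)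

open Classical in
/-- The resolvent `K_β` of `E`. It exists and is unique for every `β > 0` and every densely defined
closed nonnegative symmetric form. -/
def resolvent (E : L2Form m) (β : ℝ) : Lp ℝ 2 m →L[ℝ] Lp ℝ 2 m :=
  if h : ∃ K, E.IsResolvent β K then h.choose else 0

/-- The form `(u, v) ↦ (A u, v)` with domain `L²` of a bounded operator `A`. -/
def ofBounded (A : Lp ℝ 2 m →L[ℝ] Lp ℝ 2 m) : L2Form m where
  domain := ⊤
  form := LinearMap.mk₂ ℝ
    (fun u v : (⊤ : Submodule ℝ (Lp ℝ 2 m)) => inner ℝ (A (u : Lp ℝ 2 m)) (v : Lp ℝ 2 m))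
    (fun u u' v => by simp [inner_add_left])
    (fun c u v => by simp [real_inner_smul_left])
    (fun u v v' => by simp [inner_add_right])
    (fun c u v => by simp [real_inner_smul_right])

theorem ofBounded_form_apply (A : Lp ℝ 2 m →L[ℝ] Lp ℝ 2 m) (u v : (ofBounded A).domain) :
    (ofBounded A).form u v = inner ℝ (A (u : Lp ℝ 2 m)) (v : Lp ℝ 2 m) := rfl

/-- The approximation `E^(t)[u] = (1 / t) (u - T_t u, u)`, with domain `L²`. -/
def timeApprox (E : L2Form m) (t : ℝ) : L2Form m :=
  ofBounded (t⁻¹ • (ContinuousLinearMap.id ℝ (Lp ℝ 2 m) - E.semigroup t))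

/-- The Deny-Yosida approximation `E^(β)[u] = β (u - β K_β u, u)`, with domain `L²`. -/
def yosidaApprox (E : L2Form m) (β : ℝ) : L2Form m :=
  ofBounded (β • (ContinuousLinearMap.id ℝ (Lp ℝ 2 m) - β • E.resolvent β))

/-- `Y` is invariant for `E`: it is measurable and `T_t (1_Y u) = 1_Y T_t u` for all `u ∈ L²` and
all `t > 0`, where `(T_t)` is the semigroup related to `E`. -/
def IsInvariant (E : L2Form m) (Y : Set X) : Prop :=
  ∃ hY : MeasurableSet Y, ∀ t : ℝ, 0 < t → ∀ u : Lp ℝ 2 m,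
    E.semigroup t (indicatorMul hY u) = indicatorMul hY (E.semigroup t u)

end L2Form

end

/-! The approximating forms belong to the bounded operators (1 - T_t)/t and β(1 - βK_β). For bounded
A the semigroup is the exponential series e^{-tA}, so 1_Y commutes with all e^{-tA} exactly when it
commutes with A (`isInvariant_ofBounded_iff`). Thus (a) says that 1_Y commutes with every T_t, which
is (c), and (b) says that it commutes with every K_β.

It remains to pass between resolvent and semigroup for a bounded operator P. If P commutes with the
T_t, it commutes with the difference quotients defining L, hence with (L + β)⁻¹
(`commute_resolvent`). If P commutes with a single K_β, it preserves the graph of L; for u in dom L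
both PT_tu and T_tPu then solve the same dissipative Cauchy problem, so they agree
(`commute_semigroup`).

Since `semigroup` and `resolvent` default to 0, existence has to be proved. Riesz representation for
E + β(·,·) shows that L is m-accretive, and Yosida approximation then yields the Hille-Yosida
theorem `exists_semigroup`. -/

/-! ### Dissipative evolution and resolvents of m-accretive operators. -/

section Accretive

variable {H : Type*} [NormedAddCommGroup H] [InnerProductSpace ℝ H]

/-- A continuous curve starting at `0` whose right derivative is dissipative vanishes. -/
theorem eq_zero_of_dissipative {f g : ℝ → H} (hc : ContinuousOn f (Set.Ici 0)) (h0 : f 0 = 0)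
    (hd : ∀ s, 0 ≤ s → HasDerivWithinAt f (-g s) (Set.Ici s) s)
    (hg : ∀ s, 0 ≤ s → 0 ≤ inner ℝ (g s) (f s)) {t : ℝ} (ht : 0 ≤ t) : f t = 0 := by
  have hn : ‖f t‖ ^ 2 ≤ 0 := by
    refine image_le_of_deriv_right_le_deriv_boundary (a := 0) (b := t)
      (f := fun s => ‖f s‖ ^ 2) (f' := fun s => 2 * inner ℝ (f s) (-g s)) (B := fun _ => 0)
      (B' := fun _ => 0) ?_ ?_ ?_ continuousOn_const ?_ ?_ ⟨ht, le_rfl⟩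
    · exact ((hc.mono Set.Icc_subset_Ici_self).norm).pow 2
    · intro s hs
      exact (hd s hs.1).norm_sq
    · simp [h0]
    · intro s hs
      exact hasDerivWithinAt_const ..
    · intro s hs
      have := hg s hs.1
      rw [inner_neg_right, real_inner_comm]
      linarith
  have : ‖f t‖ = 0 := by nlinarith [norm_nonneg (f t)]
  simpa using this

/-- An m-accretive linear operator, given by its graph, with dense domain. -/
structure IsMaxAccretive (G : Submodule ℝ (H × H)) : Prop where
  accretive : ∀ u w, (u, w) ∈ G → 0 ≤ inner ℝ w u
  range : ∀ β : ℝ, 0 < β → ∀ f, ∃ u, (u, f - β • u) ∈ G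
  dense : Dense {u | ∃ w, (u, w) ∈ G}

namespace IsMaxAccretive

variable {G : Submodule ℝ (H × H)}

theorem norm_le (hG : IsMaxAccretive G) {β : ℝ} (hβ : 0 < β) {u f : H}
    (h : (u, f - β • u) ∈ G) : β * ‖u‖ ≤ ‖f‖ := by
  have h1 := hG.accretive _ _ h
  rw [inner_sub_left, real_inner_smul_left, real_inner_self_eq_norm_sq] at h1
  have h2 := real_inner_le_norm f u
  by_contra! h3
  have h4 : 0 < ‖u‖ := by
    by_contra! h5
    nlinarith [norm_nonneg f, norm_nonneg u]
  nlinarith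

theorem eq_of_mem (hG : IsMaxAccretive G) {β : ℝ} (hβ : 0 < β) {u v f : H}
    (hu : (u, f - β • u) ∈ G) (hv : (v, f - β • v) ∈ G) : u = v := by
  have h1 : (u - v, (0 : H) - β • (u - v)) ∈ G := by
    convert G.sub_mem hu hv using 1
    ext <;> simp [smul_sub]
  have h2 := hG.norm_le hβ h1
  rw [norm_zero] at h2
  have h3 : ‖u - v‖ = 0 := by nlinarith [norm_nonneg (u - v)]
  exact sub_eq_zero.1 (norm_eq_zero.1 h3)

theorem exists_resolvent (hG : IsMaxAccretive G) {β : ℝ} (hβ : 0 < β) :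
    ∃ K : H →L[ℝ] H, ∀ f, (K f, f - β • K f) ∈ G := by
  choose K hK using hG.range β hβ
  refine ⟨LinearMap.mkContinuous ⟨⟨K, fun f g => ?_⟩, fun c f => ?_⟩ β⁻¹ fun f => ?_, hK⟩
  · refine hG.eq_of_mem hβ (hK _) ?_
    convert G.add_mem (hK f) (hK g) using 1
    ext <;> simp [smul_add]
    abel
  · refine hG.eq_of_mem hβ (hK _) ?_
    convert G.smul_mem c (hK f) using 1
    ext <;> simp [smul_sub, smul_comm c β]
  · have := hG.norm_le hβ (hK f)
    rw [inv_mul_eq_div, le_div_iff₀ hβ, mul_comm]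
    exact this

end IsMaxAccretive

/-! ### Semigroups of bounded operators and contraction estimates. -/

/-- The uniformly continuous semigroup `exp (-t A)` of a bounded operator. -/
noncomputable def expSemigroup (A : H →L[ℝ] H) (t : ℝ) : H →L[ℝ] H :=
  NormedSpace.exp (t • (-A))

theorem expSemigroup_zero (A : H →L[ℝ] H) : expSemigroup A 0 = ContinuousLinearMap.id ℝ H := by
  simp only [expSemigroup, zero_smul, NormedSpace.exp_zero]; rfl

theorem expSemigroup_zero_left (t : ℝ) :
    expSemigroup (0 : H →L[ℝ] H) t = ContinuousLinearMap.id ℝ H := by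
  simp only [expSemigroup, neg_zero, smul_zero, NormedSpace.exp_zero]; rfl

theorem commute_expSemigroup {A B : H →L[ℝ] H} (h : Commute B A) (t : ℝ) :
    Commute B (expSemigroup A t) := by
  let _ : NormedAlgebra ℚ (H →L[ℝ] H) := NormedAlgebra.restrictScalars ℚ ℝ _
  exact (h.neg_right.smul_right t).exp_right

theorem expSemigroup_apply_comm {A B : H →L[ℝ] H} (h : Commute B A) (t : ℝ) (u : H) :
    B (expSemigroup A t u) = expSemigroup A t (B u) :=
  DFunLike.congr_fun (commute_expSemigroup h t).eq u

variable [CompleteSpace H]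

theorem expSemigroup_add (A : H →L[ℝ] H) (s t : ℝ) :
    expSemigroup A (s + t) = (expSemigroup A s).comp (expSemigroup A t) := by
  let _ : NormedAlgebra ℚ (H →L[ℝ] H) := NormedAlgebra.restrictScalars ℚ ℝ _
  simp only [expSemigroup, add_smul]
  exact NormedSpace.exp_add_of_commute (((Commute.refl (-A)).smul_left s).smul_right t)

theorem hasDerivAt_expSemigroup_clm (A : H →L[ℝ] H) (t : ℝ) :
    HasDerivAt (expSemigroup A) (-A * expSemigroup A t) t :=
  hasDerivAt_exp_smul_const' (-A) t

theorem hasDerivAt_expSemigroup (A : H →L[ℝ] H) (u : H) (t : ℝ) :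
    HasDerivAt (fun s => expSemigroup A s u) (-A (expSemigroup A t u)) t := by
  simpa using (hasDerivAt_expSemigroup_clm A t).clm_apply (hasDerivAt_const t u)

theorem norm_expSemigroup_apply_le {A : H →L[ℝ] H} (hA : ∀ u, 0 ≤ inner ℝ (A u) u) {t : ℝ}
    (ht : 0 ≤ t) (u : H) : ‖expSemigroup A t u‖ ≤ ‖u‖ := by
  have hd (s : ℝ) := (hasDerivAt_expSemigroup A u s).norm_sq
  have := antitone_of_deriv_nonpos (fun s => (hd s).differentiableAt) (fun s => by
    rw [(hd s).deriv, inner_neg_right, real_inner_comm]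
    linarith [hA (expSemigroup A s u)]) ht
  simp only [expSemigroup_zero, ContinuousLinearMap.id_apply] at this
  exact (sq_le_sq₀ (norm_nonneg _) (norm_nonneg u)).1 this

/-- Interpolate by s ↦ e^{-sA} e^{-(t-s)B} u. Commutation makes its derivative -e^{-sA}
e^{-(t-s)B}(Au - Bu), and both exponentials are contractions. -/
theorem norm_expSemigroup_sub_le {A B : H →L[ℝ] H} (hA : ∀ u, 0 ≤ inner ℝ (A u) u)
    (hB : ∀ u, 0 ≤ inner ℝ (B u) u) (h : Commute A B) {t : ℝ} (ht : 0 ≤ t) (u : H) :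
    ‖expSemigroup A t u - expSemigroup B t u‖ ≤ t * ‖A u - B u‖ := by
  have hd (s : ℝ) : HasDerivAt (fun s => expSemigroup A s (expSemigroup B (t - s) u))
      (-expSemigroup A s (expSemigroup B (t - s) (A u - B u))) s := by
    have h1 : HasDerivAt (fun s : ℝ => expSemigroup B (t - s) u)
        (B (expSemigroup B (t - s) u)) s := by
      simpa [Function.comp_def] using
        (hasDerivAt_expSemigroup B u (t - s)).scomp s ((hasDerivAt_id s).const_sub t)
    convert (hasDerivAt_expSemigroup_clm A s).clm_apply h1 using 1
    have h2 := expSemigroup_apply_comm (Commute.refl A) s (expSemigroup B (t - s) u)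
    have h3 := expSemigroup_apply_comm (Commute.refl B) (t - s) u
    have h4 := expSemigroup_apply_comm h (t - s) u
    simp only [map_sub, mul_apply_eq_comp, neg_apply, h2, h3, h4]
    abel
  have := norm_image_sub_le_of_norm_deriv_le_segment' (a := 0) (b := t) (C := ‖A u - B u‖)
    (fun s _ => (hd s).hasDerivWithinAt) (fun s hs => by
      rw [norm_neg]
      exact (norm_expSemigroup_apply_le hA hs.1 _).trans
        (norm_expSemigroup_apply_le hB (by linarith [hs.2]) _)) t ⟨ht, le_rfl⟩
  simpa [expSemigroup_zero, mul_comm] using this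

theorem norm_expSemigroup_sub_self_le {A : H →L[ℝ] H} (hA : ∀ u, 0 ≤ inner ℝ (A u) u)
    {t : ℝ} (ht : 0 ≤ t) (u : H) : ‖expSemigroup A t u - u‖ ≤ t * ‖A u‖ := by
  simpa [expSemigroup_zero_left] using
    norm_expSemigroup_sub_le (B := 0) hA (by simp) (Commute.zero_right A) ht u

/-- A first-order expansion at t = 0 that does not involve ‖A‖, hence is uniform along Yosida
approximations. It integrates e^{-sA}Au - w = e^{-sA}(Au - w) + (e^{-sA}w - w). -/
theorem norm_sub_expSemigroup_sub_smul_le {A : H →L[ℝ] H} (hA : ∀ u, 0 ≤ inner ℝ (A u) u)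
    {t c : ℝ} (ht : 0 ≤ t) (u w : H) (hc : ∀ s, 0 ≤ s → s ≤ t → ‖expSemigroup A s w - w‖ ≤ c) :
    ‖u - expSemigroup A t u - t • w‖ ≤ t * (‖A u - w‖ + c) := by
  have hd (s : ℝ) : HasDerivAt (fun s => u - expSemigroup A s u - s • w)
      (expSemigroup A s (A u - w) + (expSemigroup A s w - w)) s := by
    refine (((hasDerivAt_expSemigroup A u s).const_sub u).sub
      ((hasDerivAt_id s).smul_const w)).congr_deriv ?_
    rw [expSemigroup_apply_comm (Commute.refl A)]
    simp
  have := norm_image_sub_le_of_norm_deriv_le_segment' (a := 0) (b := t) (C := ‖A u - w‖ + c)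
    (fun s _ => (hd s).hasDerivWithinAt) (fun s hs => (norm_add_le _ _).trans
      (add_le_add (norm_expSemigroup_apply_le hA hs.1 _) (hc s hs.1 hs.2.le))) t ⟨ht, le_rfl⟩
  simpa [expSemigroup_zero, mul_comm] using this

/-- A sequence of contractions that is Cauchy on a dense set converges strongly. -/
theorem exists_tendsto_of_contraction {L : ℕ → H →L[ℝ] H} (hL : ∀ n u, ‖L n u‖ ≤ ‖u‖)
    {D : Set H} (hD : Dense D) (hC : ∀ u ∈ D, CauchySeq fun n => L n u) :
    ∃ T : H →L[ℝ] H, ∀ u, Tendsto (fun n => L n u) atTop (𝓝 (T u)) := by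
  have key (u : H) : ∃ v, Tendsto (fun n => L n u) atTop (𝓝 v) := by
    refine cauchySeq_tendsto_of_complete (Metric.cauchySeq_iff.2 fun ε hε => ?_)
    obtain ⟨u', hu', hd⟩ := hD.exists_dist_lt u (by positivity : 0 < ε / 3)
    obtain ⟨N, hN⟩ := Metric.cauchySeq_iff.1 (hC u' hu') (ε / 3) (by positivity)
    refine ⟨N, fun i hi j hj => ?_⟩
    have h1 (n : ℕ) : dist (L n u) (L n u') < ε / 3 := by
      rw [dist_eq_norm, ← map_sub]
      exact (hL n _).trans_lt (by rwa [← dist_eq_norm])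
    have h2 := dist_triangle4 (L i u) (L i u') (L j u') (L j u)
    have h3 := h1 j
    rw [dist_comm] at h3
    linarith [h1 i, hN i hi j hj]
  choose T hT using key
  exact ⟨continuousLinearMapOfTendsto L (f := T) (tendsto_pi_nhds.2 hT), hT⟩

/-! ### The Hille-Yosida theorem. -/

namespace IsMaxAccretive

variable {G : Submodule ℝ (H × H)}

/-- The Yosida approximations of an m-accretive operator. -/
theorem exists_yosida (hG : IsMaxAccretive G) : ∃ A : ℕ → H →L[ℝ] H,
    (∀ n u, 0 ≤ inner ℝ (A n u) u) ∧ (∀ i j, Commute (A i) (A j)) ∧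
    (∀ u w, (u, w) ∈ G → ∀ n, ‖A n u‖ ≤ ‖w‖) ∧
    ∀ u w, (u, w) ∈ G → Tendsto (fun n => A n u) atTop (𝓝 w) := by
  have hβ (n : ℕ) : (0 : ℝ) < n + 1 := by positivity
  choose K hK using fun n : ℕ => hG.exists_resolvent (hβ n)
  have hKG (n : ℕ) {u w : H} (h : (u, w) ∈ G) : K n (w + ((n : ℝ) + 1) • u) = u :=
    hG.eq_of_mem (hβ n) (hK n _) (by simpa using h)
  have hc (n : ℕ) (w : H) : ‖((n : ℝ) + 1) • K n w‖ ≤ ‖w‖ := by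
    rw [norm_smul, Real.norm_of_nonneg (hβ n).le]
    exact hG.norm_le (hβ n) (hK n w)
  -- With β = n + 1, the Yosida approximation β(1 - βK_β) acts on the domain as βK_β applied to the
  -- image w; contractivity and convergence of βK_β then give both claims about A_n u.
  have hA (n : ℕ) {u w : H} (h : (u, w) ∈ G) :
      ((n : ℝ) + 1) • (u - ((n : ℝ) + 1) • K n u) = ((n : ℝ) + 1) • K n w := by
    have := hKG n h
    rw [map_add, map_smul] at this
    rw [← eq_sub_iff_add_eq.2 this]
  have hcomm (i j : ℕ) : Commute (K i) (K j) := by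
    rcases eq_or_ne i j with rfl | hij
    · exact Commute.refl _
    have hne : (i : ℝ) - j ≠ 0 := sub_ne_zero.2 (by exact_mod_cast hij)
    -- The resolvent identity; its right side is antisymmetric in i and j, so dividing by i - j ≠ 0
    -- gives commutation.
    have hres (i j : ℕ) (f : H) : ((i : ℝ) - j) • K i (K j f) = K j f - K i f := by
      have := hKG i (hK j f)
      rw [show f - ((j : ℝ) + 1) • K j f + ((i : ℝ) + 1) • K j f = f + ((i : ℝ) - j) • K j f by
        module, map_add, map_smul] at this
      rw [eq_sub_iff_add_eq, add_comm]
      exact this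
    ext f
    refine smul_right_injective H hne ?_
    change ((i : ℝ) - j) • K i (K j f) = ((i : ℝ) - j) • K j (K i f)
    rw [hres, ← neg_sub (j : ℝ) i, neg_smul, hres, neg_sub]
  have hlim (w : H) : Tendsto (fun n : ℕ => ((n : ℝ) + 1) • K n w) atTop (𝓝 w) := by
    have hdom : ∀ u ∈ {u | ∃ w, (u, w) ∈ G},
        Tendsto (fun n : ℕ => (((n : ℝ) + 1) • K n) u) atTop (𝓝 u) := by
      rintro u ⟨w, h⟩
      rw [tendsto_iff_norm_sub_tendsto_zero]
      have hz : Tendsto (fun n : ℕ => ‖w‖ * (1 / ((n : ℝ) + 1))) atTop (𝓝 0) := by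
        simpa using (tendsto_one_div_add_atTop_nhds_zero_nat (𝕜 := ℝ)).const_mul ‖w‖
      refine squeeze_zero (fun _ => norm_nonneg _) (fun n => ?_) hz
      have h1 : u - ((n : ℝ) + 1) • K n u = K n w := smul_right_injective H (hβ n).ne' (hA n h)
      rw [smul_apply, norm_sub_rev, h1, mul_one_div, le_div_iff₀ (hβ n),
        mul_comm]
      exact hG.norm_le (hβ n) (hK n w)
    obtain ⟨T, hT⟩ := exists_tendsto_of_contraction (L := fun n : ℕ => ((n : ℝ) + 1) • K n) hc
      hG.dense fun u hu => (hdom u hu).cauchySeq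
    have : (T : H → H) = id := Continuous.ext_on hG.dense T.continuous continuous_id
      fun u hu => tendsto_nhds_unique (hT u) (hdom u hu)
    have h2 := hT w
    rwa [this] at h2
  refine ⟨fun n => ((n : ℝ) + 1) • (1 - ((n : ℝ) + 1) • K n), fun n u => ?_, fun i j => ?_,
    fun u w h n => ?_, fun u w h => ?_⟩
  · have h1 := hG.accretive _ _ (hK n u)
    -- Write u = (u - βK_βu) + βK_βu; the second part is controlled by accretivity at (K_βu, u -
    -- βK_βu).
    have h2 : inner ℝ (((n : ℝ) + 1) • (u - ((n : ℝ) + 1) • K n u)) u = ((n : ℝ) + 1) *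
        (inner ℝ (u - ((n : ℝ) + 1) • K n u) (u - ((n : ℝ) + 1) • K n u) + ((n : ℝ) + 1) *
          inner ℝ (u - ((n : ℝ) + 1) • K n u) (K n u)) := by
      rw [← real_inner_smul_right, ← inner_add_right, sub_add_cancel, real_inner_smul_left]
    change 0 ≤ inner ℝ (((n : ℝ) + 1) • (u - ((n : ℝ) + 1) • K n u)) u
    rw [h2]
    have := hβ n
    exact mul_nonneg this.le (add_nonneg real_inner_self_nonneg (mul_nonneg this.le h1))
  · refine Commute.smul_left (Commute.smul_right ?_ _) _
    refine Commute.sub_left (Commute.one_left _) (Commute.sub_right (Commute.one_right _) ?_)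
    exact ((hcomm i j).smul_left _).smul_right _
  · exact (congrArg norm (hA n h)).trans_le (hc n w)
  · exact (hlim w).congr fun n => (hA n h).symm

/-- The Hille-Yosida theorem: an m-accretive operator generates a contraction semigroup. -/
theorem exists_semigroup (hG : IsMaxAccretive G) : ∃ T : ℝ → H →L[ℝ] H,
    T 0 = ContinuousLinearMap.id ℝ H ∧
    (∀ s t, 0 ≤ s → 0 ≤ t → T (s + t) = (T s).comp (T t)) ∧
    (∀ u, ContinuousOn (fun t => T t u) (Set.Ici 0)) ∧
    ∀ u w, (u, w) ∈ G ↔ Tendsto (fun t : ℝ => t⁻¹ • (u - T t u)) (𝓝[>] 0) (𝓝 w) := by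
  obtain ⟨A, hacc, hcomm, hAn, hAt⟩ := hG.exists_yosida
  have hex (t : ℝ) : ∃ T : H →L[ℝ] H, 0 ≤ t →
      ∀ u, Tendsto (fun n => expSemigroup (A n) t u) atTop (𝓝 (T u)) := by
    by_cases ht : 0 ≤ t
    · obtain ⟨T, hT⟩ := exists_tendsto_of_contraction
        (fun n u => norm_expSemigroup_apply_le (hacc n) ht u) hG.dense (fun u hu => by
          obtain ⟨w, h⟩ := hu
          refine Metric.cauchySeq_iff.2 fun ε hε => ?_
          obtain ⟨N, hN⟩ := Metric.cauchySeq_iff.1 (hAt u w h).cauchySeq (ε / (t + 1))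
            (by positivity)
          refine ⟨N, fun i hi j hj => ?_⟩
          have h1 := norm_expSemigroup_sub_le (hacc i) (hacc j) (hcomm i j) ht u
          have h2 := hN i hi j hj
          rw [dist_eq_norm, lt_div_iff₀ (by positivity)] at h2
          rw [dist_eq_norm]
          nlinarith [norm_nonneg (A i u - A j u)])
      exact ⟨T, fun _ => hT⟩
    · exact ⟨0, fun h => absurd h ht⟩
  choose T hT using hex
  have hTc {t : ℝ} (ht : 0 ≤ t) (u : H) : ‖T t u‖ ≤ ‖u‖ :=
    le_of_tendsto (hT t ht u).norm
      (Eventually.of_forall fun n => norm_expSemigroup_apply_le (hacc n) ht u)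
  have hadd {s t : ℝ} (hs : 0 ≤ s) (ht : 0 ≤ t) (u : H) : T (s + t) u = T s (T t u) := by
    refine tendsto_nhds_unique (hT (s + t) (add_nonneg hs ht) u) ?_
    have h1 : Tendsto (fun n => expSemigroup (A n) s (expSemigroup (A n) t u - T t u)) atTop
        (𝓝 0) :=
      squeeze_zero_norm (fun n => norm_expSemigroup_apply_le (hacc n) hs _)
        (tendsto_iff_norm_sub_tendsto_zero.1 (hT t ht u))
    have h2 := h1.add (hT s hs (T t u))
    rw [zero_add] at h2
    refine h2.congr fun n => ?_
    rw [map_sub, sub_add_cancel, expSemigroup_add]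
    rfl
  have hzero (u : H) : T 0 u = u := by
    refine tendsto_nhds_unique (hT 0 le_rfl u) ?_
    simp only [expSemigroup_zero]
    exact tendsto_const_nhds
  have hdist {u w : H} (h : (u, w) ∈ G) {s t : ℝ} (hs : 0 ≤ s) (hst : s ≤ t) :
      ‖T t u - T s u‖ ≤ (t - s) * ‖w‖ := by
    have h1 : ‖T (t - s) u - u‖ ≤ (t - s) * ‖w‖ :=
      le_of_tendsto ((hT _ (sub_nonneg.2 hst) u).sub_const u).norm
        (Eventually.of_forall fun n =>
          (norm_expSemigroup_sub_self_le (hacc n) (sub_nonneg.2 hst) u).trans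
            (mul_le_mul_of_nonneg_left (hAn u w h n) (sub_nonneg.2 hst)))
    have h2 := hadd hs (sub_nonneg.2 hst) u
    rw [add_sub_cancel] at h2
    rw [h2, ← map_sub]
    exact (hTc hs _).trans h1
  have hdist' {u w : H} (h : (u, w) ∈ G) {s t : ℝ} (hs : 0 ≤ s) (ht : 0 ≤ t) :
      ‖T t u - T s u‖ ≤ |t - s| * ‖w‖ := by
    rcases le_total s t with hst | hst
    · rw [abs_of_nonneg (sub_nonneg.2 hst)]
      exact hdist h hs hst
    · rw [abs_sub_comm, norm_sub_rev, abs_of_nonneg (sub_nonneg.2 hst)]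
      exact hdist h ht hst
  have hgen {u w : H} (h : (u, w) ∈ G) :
      Tendsto (fun t : ℝ => t⁻¹ • (u - T t u)) (𝓝[>] 0) (𝓝 w) := by
    -- Since w need not lie in the domain, e^{-sA_n}w - w is estimated through a nearby w' that
    -- does, at the cost 2‖w - w'‖.
    have hb {w' z : H} (h' : (w', z) ∈ G) {t : ℝ} (ht : 0 < t) :
        ‖t⁻¹ • (u - T t u) - w‖ ≤ 2 * ‖w - w'‖ + t * ‖z‖ := by
      have h1 (n : ℕ) : ‖u - expSemigroup (A n) t u - t • w‖ ≤
          t * (‖A n u - w‖ + (2 * ‖w - w'‖ + t * ‖z‖)) := by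
        refine norm_sub_expSemigroup_sub_smul_le (hacc n) ht.le u w fun s hs hst => ?_
        have e : expSemigroup (A n) s w - w = expSemigroup (A n) s (w - w') +
            (expSemigroup (A n) s w' - w') - (w - w') := by
          rw [map_sub]; abel
        have h2 := norm_expSemigroup_apply_le (hacc n) hs (w - w')
        have h3 := norm_expSemigroup_sub_self_le (hacc n) hs w'
        have h4 : s * ‖A n w'‖ ≤ t * ‖z‖ :=
          mul_le_mul hst (hAn w' z h' n) (norm_nonneg _) ht.le
        rw [e]
        refine (norm_sub_le _ _).trans ?_
        linarith [norm_add_le (expSemigroup (A n) s (w - w')) (expSemigroup (A n) s w' - w')]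
      have h5 : ‖u - T t u - t • w‖ ≤ t * (0 + (2 * ‖w - w'‖ + t * ‖z‖)) :=
        le_of_tendsto_of_tendsto' (((hT t ht.le u).const_sub u).sub_const (t • w)).norm
          (((tendsto_iff_norm_sub_tendsto_zero.1 (hAt u w h)).add_const _).const_mul t) h1
      have h6 : t⁻¹ • (u - T t u) - w = t⁻¹ • (u - T t u - t • w) := by
        rw [smul_sub _ _ (t • w), inv_smul_smul₀ ht.ne']
      rw [h6, norm_smul, norm_inv, Real.norm_of_nonneg ht.le, inv_mul_le_iff₀ ht]
      simpa using h5
    refine Metric.tendsto_nhds.2 fun ε hε => ?_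
    obtain ⟨w', ⟨z, h'⟩, hw'⟩ := hG.dense.exists_dist_lt w (by positivity : 0 < ε / 4)
    have hδ : 0 < ε / (2 * (‖z‖ + 1)) := by positivity
    filter_upwards [Ioo_mem_nhdsGT hδ] with t ht
    have h1 := hb h' ht.1
    have h2 := ht.2
    rw [lt_div_iff₀ (by positivity)] at h2
    rw [dist_eq_norm] at hw' ⊢
    nlinarith [ht.1]
  refine ⟨T, ContinuousLinearMap.ext hzero, fun s t hs ht => ContinuousLinearMap.ext
    (hadd hs ht), fun u => ?_, fun u w => ⟨hgen, fun hlim => ?_⟩⟩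
  · refine Metric.continuousOn_iff.2 fun s hs ε hε => ?_
    obtain ⟨u', ⟨w, h⟩, hu'⟩ := hG.dense.exists_dist_lt u (by positivity : 0 < ε / 3)
    refine ⟨ε / (3 * (‖w‖ + 1)), by positivity, fun t ht hts => ?_⟩
    rw [dist_eq_norm] at hu' ⊢
    rw [Real.dist_eq, lt_div_iff₀ (by positivity)] at hts
    have h1 := hdist' h (Set.mem_Ici.1 hs) (Set.mem_Ici.1 ht)
    have h2 := hTc (Set.mem_Ici.1 ht) (u - u')
    have h3 := hTc (Set.mem_Ici.1 hs) (u - u')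
    have e : T t u - T s u = T t (u - u') + (T t u' - T s u') - T s (u - u') := by
      simp only [map_sub]; abel
    rw [e]
    refine (norm_sub_le _ _).trans_lt ?_
    have h4 := norm_add_le (T t (u - u')) (T t u' - T s u')
    nlinarith [abs_nonneg (t - s)]
  -- Maximality: the generator extends G and is accretive because T is contractive. Solving in G
  -- with β = 1 gives v for which the generator sends u - v to -(u - v), forcing u = v.
  · obtain ⟨v, hv⟩ := hG.range 1 one_pos (w + u)
    have h1 := hlim.sub (hgen hv)
    have h2 : Tendsto (fun t : ℝ => inner ℝ (t⁻¹ • (u - v - T t (u - v))) (u - v)) (𝓝[>] 0)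
        (𝓝 (inner ℝ (-(u - v)) (u - v))) := by
      refine Tendsto.inner ?_ tendsto_const_nhds
      convert h1 using 2
      · rw [map_sub, ← smul_sub]
        congr 1
        abel
      · rw [one_smul]; abel
    have h3 : 0 ≤ inner ℝ (-(u - v)) (u - v) := by
      refine ge_of_tendsto h2 ?_
      filter_upwards [self_mem_nhdsWithin] with t ht
      have ht : 0 < t := ht
      rw [real_inner_smul_left, inner_sub_left, real_inner_self_eq_norm_sq]
      have h4 := real_inner_le_norm (T t (u - v)) (u - v)
      have h5 := hTc ht.le (u - v)
      exact mul_nonneg (inv_nonneg.2 ht.le) (by nlinarith [norm_nonneg (u - v)])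
    rw [inner_neg_left, real_inner_self_eq_norm_sq] at h3
    have h4 : ‖u - v‖ = 0 := by nlinarith [norm_nonneg (u - v)]
    obtain rfl := sub_eq_zero.1 (norm_eq_zero.1 h4)
    simpa using hv

end IsMaxAccretive

end Accretive

/-! ### Riesz representation and multiplication by indicators. -/

/-- The Riesz representation theorem for a positive definite symmetric bilinear form whose
Cauchy sequences converge. -/
theorem exists_bilinForm_eq {V : Type*} [AddCommGroup V] [Module ℝ V]
    (B : LinearMap.BilinForm ℝ V) (hsymm : ∀ u v, B u v = B v u) (hpos : ∀ v, 0 ≤ B v v)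
    (hdef : ∀ v, B v v = 0 → v = 0)
    (hcomplete : ∀ u : ℕ → V, (∀ ε : ℝ, 0 < ε → ∃ N : ℕ, ∀ j k : ℕ, N ≤ j → N ≤ k →
      B (u j - u k) (u j - u k) < ε) → ∃ v, Tendsto (fun k => B (u k - v) (u k - v)) atTop (𝓝 0))
    (l : V →ₗ[ℝ] ℝ) (C : ℝ) (hl : ∀ v, |l v| ≤ C * √(B v v)) : ∃ u, ∀ v, B u v = l v := by
  let core : InnerProductSpace.Core ℝ V :=
    { inner := fun u v => B u v
      conj_inner_symm := fun u v => hsymm v u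
      re_inner_nonneg := hpos
      add_left := fun u v w => by simp
      smul_left := fun u v c => by simp
      definite := hdef }
  let _ : NormedAddCommGroup V := core.toNormedAddCommGroup
  let _ : InnerProductSpace ℝ V := InnerProductSpace.ofCore core.toCore
  have hn (v : V) : ‖v‖ = √(B v v) := rfl
  have _ : CompleteSpace V := by
    refine Metric.complete_of_cauchySeq_tendsto fun u hu => ?_
    obtain ⟨v, hv⟩ := hcomplete u fun ε hε => by
      obtain ⟨N, hN⟩ := Metric.cauchySeq_iff.1 hu (√ε) (Real.sqrt_pos.2 hε)
      refine ⟨N, fun j k hj hk => ?_⟩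
      have := hN j hj k hk
      rwa [dist_eq_norm, hn, Real.sqrt_lt_sqrt_iff (hpos _)] at this
    refine ⟨v, tendsto_iff_norm_sub_tendsto_zero.2 ?_⟩
    simpa [hn] using hv.sqrt
  let f : V →L[ℝ] ℝ := l.mkContinuous C hl
  exact ⟨(InnerProductSpace.toDual ℝ V).symm f, fun v =>
    InnerProductSpace.toDual_symm_apply (𝕜 := ℝ) (x := v) (y := f)⟩

section Indicator

variable {X : Type*} [MeasurableSpace X] {m : Measure X}

theorem coeFn_indicatorMul {Y : Set X} (hY : MeasurableSet Y) (u : Lp ℝ 2 m) :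
    indicatorMul hY u =ᵐ[m] Y.indicator u :=
  MemLp.coeFn_toLp _

/-- Multiplication by an indicator function as a bounded operator on `L²`. -/
noncomputable def indicatorCLM {Y : Set X} (hY : MeasurableSet Y) : Lp ℝ 2 m →L[ℝ] Lp ℝ 2 m :=
  LinearMap.mkContinuous
    ⟨⟨indicatorMul hY, fun u v => by
        apply Lp.ext
        filter_upwards [coeFn_indicatorMul hY (u + v), coeFn_indicatorMul hY u,
          coeFn_indicatorMul hY v, Lp.coeFn_add u v,
          Lp.coeFn_add (indicatorMul hY u) (indicatorMul hY v)] with x h1 h2 h3 h4 h5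
        rw [h1, h5, Pi.add_apply, h2, h3]
        by_cases hx : x ∈ Y
        · simpa only [Set.indicator_of_mem hx] using! h4
        · simp [hx]⟩, fun c u => by
        apply Lp.ext
        filter_upwards [coeFn_indicatorMul hY (c • u), coeFn_indicatorMul hY u,
          Lp.coeFn_smul c u, Lp.coeFn_smul c (indicatorMul hY u)] with x h1 h2 h3 h4
        simp only [RingHom.id_apply]
        rw [h1, h4, Pi.smul_apply, h2]
        by_cases hx : x ∈ Y
        · simpa only [Set.indicator_of_mem hx] using! h3
        · simp [hx]⟩
    1 fun u => by
      rw [one_mul]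
      refine Lp.norm_le_norm_of_ae_le ?_
      filter_upwards [coeFn_indicatorMul hY u] with x h1
      change ‖indicatorMul hY u x‖ ≤ _
      rw [h1]
      exact norm_indicator_le_norm_self _ _

end Indicator

/-! ### The operator, semigroup and resolvent of a form. -/

namespace L2Form

variable {X : Type*} [MeasurableSpace X] {m : Measure X} {E : L2Form m}

/-- The graph of the operator associated with a form. -/
def operatorSubmodule (E : L2Form m) : Submodule ℝ (Lp ℝ 2 m × Lp ℝ 2 m) where
  carrier := {p | E.OperatorGraph p.1 p.2}
  zero_mem' := ⟨E.domain.zero_mem, fun v => by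
    rw [Prod.snd_zero, inner_zero_left]
    exact DFunLike.congr_fun (map_zero E.form) v⟩
  add_mem' := by
    rintro ⟨u, w⟩ ⟨u', w'⟩ ⟨hu, h⟩ ⟨hu', h'⟩
    refine ⟨E.domain.add_mem hu hu', fun v => ?_⟩
    rw [Prod.snd_add, inner_add_left, ← h v, ← h' v, ← LinearMap.add_apply, ← map_add]
    rfl
  smul_mem' := by
    rintro c ⟨u, w⟩ ⟨hu, h⟩
    refine ⟨E.domain.smul_mem c hu, fun v => ?_⟩
    rw [Prod.smul_snd, real_inner_smul_left, ← h v, ← smul_eq_mul, ← LinearMap.smul_apply,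
      ← map_smul]
    rfl

theorem mem_operatorSubmodule {u w : Lp ℝ 2 m} :
    (u, w) ∈ E.operatorSubmodule ↔ E.OperatorGraph u w := Iff.rfl

theorem IsDirichletForm.exists_operatorGraph (hE : E.IsDirichletForm) {β : ℝ} (hβ : 0 < β)
    (f : Lp ℝ 2 m) : ∃ u, E.OperatorGraph u (f - β • u) := by
  let B : LinearMap.BilinForm ℝ E.domain := E.form + β • innerₗ E.domain
  have hB (u v : E.domain) : B u v = E.form u v + β * inner ℝ u v := rfl
  have hB' (u : E.domain) : B u u = E.form u u + β * ‖u‖ ^ 2 := by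
    rw [hB, real_inner_self_eq_norm_sq]
  have hnorm (v : E.domain) : ‖v‖ ^ 2 ≤ β⁻¹ * B v v := by
    rw [hB', inv_mul_eq_div, le_div_iff₀ hβ]
    linarith [hE.nonneg v]
  obtain ⟨u, hu⟩ := exists_bilinForm_eq B
    (fun u v => by rw [hB, hB, hE.symm, real_inner_comm])
    (fun v => by
      rw [hB']
      have := hE.nonneg v
      positivity)
    (fun v hv => by
      have := hnorm v
      rw [hv, mul_zero] at this
      simpa using this.antisymm (sq_nonneg _))
    (fun u hu => by
      obtain ⟨v, hv⟩ := hE.closed u fun ε hε => by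
        -- The constant comes from E[v] + ‖v‖² ≤ (1 + β⁻¹) B(v, v).
        obtain ⟨N, hN⟩ := hu (ε / (1 + β⁻¹)) (by positivity)
        refine ⟨N, fun j k hj hk => ?_⟩
        have h1 := hN j k hj hk
        rw [lt_div_iff₀ (by positivity)] at h1
        have h2 := hnorm (u j - u k)
        have h3 := hB' (u j - u k)
        have h4 : 0 ≤ β * ‖u j - u k‖ ^ 2 := by positivity
        linarith
      refine ⟨v, ?_⟩
      have h0 : Tendsto (fun k => (1 + β) * (E.form (u k - v) (u k - v) + ‖u k - v‖ ^ 2))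
          atTop (𝓝 0) := by simpa using hv.const_mul (1 + β)
      refine squeeze_zero (fun k => ?_) (fun k => ?_) h0
      · rw [hB']
        have := hE.nonneg (u k - v)
        positivity
      · rw [hB']
        have h1 := mul_nonneg hβ.le (hE.nonneg (u k - v))
        have h2 := sq_nonneg ‖u k - v‖
        linarith)
    (innerₗ (Lp ℝ 2 m) f ∘ₗ E.domain.subtype) (‖f‖ * √(β⁻¹)) (fun v => by
      change |inner ℝ f (v : Lp ℝ 2 m)| ≤ _
      refine (abs_real_inner_le_norm _ _).trans ?_
      rw [mul_assoc, ← Real.sqrt_mul (by positivity)]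
      exact mul_le_mul_of_nonneg_left (Real.le_sqrt_of_sq_le (hnorm v)) (norm_nonneg f))
  refine ⟨u, u.2, fun v => ?_⟩
  have h := hu v
  rw [hB] at h
  change E.form u v + β * inner ℝ (u : Lp ℝ 2 m) (v : Lp ℝ 2 m) =
    inner ℝ f (v : Lp ℝ 2 m) at h
  rw [inner_sub_left, real_inner_smul_left]
  change E.form u v = _
  linarith

theorem IsDirichletForm.isMaxAccretive (hE : E.IsDirichletForm) :
    IsMaxAccretive E.operatorSubmodule where
  accretive := by
    rintro u w ⟨hu, h⟩
    exact (h ⟨u, hu⟩).symm ▸ hE.nonneg ⟨u, hu⟩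
  range β hβ f := hE.exists_operatorGraph hβ f
  dense := by
    let D : Submodule ℝ (Lp ℝ 2 m) := E.operatorSubmodule.map (LinearMap.fst ℝ _ _)
    have hD : {u | ∃ w, (u, w) ∈ E.operatorSubmodule} = (D : Set (Lp ℝ 2 m)) := by
      ext u
      simp [D]
    rw [hD, Submodule.dense_iff_topologicalClosure_eq_top,
      Submodule.topologicalClosure_eq_top_iff, Submodule.eq_bot_iff]
    intro f hf
    rw [Submodule.mem_orthogonal'] at hf
    -- For f orthogonal to dom L and u = (L + 1)⁻¹f, 0 = (f, u) = E[u] + ‖u‖² gives u = 0. Then f is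
    -- orthogonal to the dense form domain.
    obtain ⟨u, hu, h⟩ := hE.exists_operatorGraph one_pos f
    have h1 : inner ℝ f u = 0 := hf u ⟨(u, f - (1 : ℝ) • u), ⟨hu, h⟩, rfl⟩
    have h2 := (h ⟨u, hu⟩).symm ▸ hE.nonneg ⟨u, hu⟩
    rw [one_smul, inner_sub_left, real_inner_self_eq_norm_sq] at h2
    have h3 : u = 0 := norm_eq_zero.1 (by nlinarith [norm_nonneg u])
    subst h3
    refine hE.dense.eq_zero_of_inner_left ℝ fun v hv => ?_
    have h4 := h ⟨v, hv⟩
    rw [smul_zero, sub_zero] at h4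
    rw [← h4]
    exact DFunLike.congr_fun (map_zero E.form) ⟨v, hv⟩

theorem IsDirichletForm.isSemigroup_semigroup (hE : E.IsDirichletForm) :
    E.IsSemigroup E.semigroup := by
  have h : ∃ T, E.IsSemigroup T := by
    obtain ⟨T, h1, h2, h3, h4⟩ := hE.isMaxAccretive.exists_semigroup
    exact ⟨T, h1, h2, h3, h4⟩
  rw [semigroup, dif_pos h]
  exact h.choose_spec

theorem IsDirichletForm.operatorGraph_resolvent (hE : E.IsDirichletForm) {β : ℝ} (hβ : 0 < β)
    (f : Lp ℝ 2 m) : E.OperatorGraph (E.resolvent β f) (f - β • E.resolvent β f) := by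
  have h : ∃ K, E.IsResolvent β K := by
    obtain ⟨K, hK⟩ := hE.isMaxAccretive.exists_resolvent hβ
    refine ⟨K, fun f => ⟨(hK f).1, fun v => ?_⟩⟩
    rw [(hK f).2 v, inner_sub_left, real_inner_smul_left, sub_add_cancel]
  rw [resolvent, dif_pos h]
  obtain ⟨h1, h2⟩ := h.choose_spec f
  refine ⟨h1, fun v => ?_⟩
  rw [inner_sub_left, real_inner_smul_left, ← h2 v, add_sub_cancel_right]

theorem IsDirichletForm.resolvent_eq (hE : E.IsDirichletForm) {β : ℝ} (hβ : 0 < β)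
    {u f : Lp ℝ 2 m} (h : E.OperatorGraph u (f - β • u)) : E.resolvent β f = u :=
  hE.isMaxAccretive.eq_of_mem hβ (hE.operatorGraph_resolvent hβ f) h

namespace IsSemigroup

variable {T : ℝ → Lp ℝ 2 m →L[ℝ] Lp ℝ 2 m}

/-- T_s is continuous and commutes with the difference quotients that define the generator. -/
theorem operatorGraph_apply (hT : E.IsSemigroup T) {u w : Lp ℝ 2 m} (h : E.OperatorGraph u w)
    {s : ℝ} (hs : 0 ≤ s) : E.OperatorGraph (T s u) (T s w) := by
  rw [hT.generator] at h ⊢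
  refine (((T s).continuous.tendsto w).comp h).congr' ?_
  filter_upwards [self_mem_nhdsWithin] with t ht
  have ht : 0 < t := ht
  have h1 : T s (T t u) = T t (T s u) := by
    rw [← ContinuousLinearMap.comp_apply, ← ContinuousLinearMap.comp_apply, ← hT.add s t hs ht.le,
      ← hT.add t s ht.le hs, add_comm]
  simp [h1]

theorem hasDerivWithinAt (hT : E.IsSemigroup T) {u w : Lp ℝ 2 m} (h : E.OperatorGraph u w)
    {s : ℝ} (hs : 0 ≤ s) : HasDerivWithinAt (fun t => T t u) (-(T s w)) (Set.Ici s) s := by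
  rw [← hasDerivWithinAt_Ioi_iff_Ici, hasDerivWithinAt_iff_tendsto_slope' Set.self_notMem_Ioi]
  have h1 : Tendsto (fun y : ℝ => y - s) (𝓝[>] s) (𝓝[>] 0) := by
    refine tendsto_nhdsWithin_iff.2 ⟨?_, ?_⟩
    · have : Tendsto (fun y : ℝ => y - s) (𝓝 s) (𝓝 (s - s)) := tendsto_id.sub_const s
      rw [sub_self] at this
      exact this.mono_left nhdsWithin_le_nhds
    · filter_upwards [self_mem_nhdsWithin] with y hy using sub_pos.2 (Set.mem_Ioi.1 hy)
  have h2 := (((hT.generator _ _).1 (hT.operatorGraph_apply h hs)).comp h1).neg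
  refine h2.congr' ?_
  filter_upwards [self_mem_nhdsWithin] with y hy
  have h3 : T y u = T (y - s) (T s u) := by
    rw [← ContinuousLinearMap.comp_apply, ← hT.add _ _ (sub_pos.2 (Set.mem_Ioi.1 hy)).le hs, sub_add_cancel]
  rw [slope_def_module, Function.comp_apply, h3, ← smul_neg, neg_sub]

end IsSemigroup

/-! ### Forms of bounded operators and their invariant sets. -/

theorem operatorGraph_ofBounded {A : Lp ℝ 2 m →L[ℝ] Lp ℝ 2 m} {u w : Lp ℝ 2 m} :
    (ofBounded A).OperatorGraph u w ↔ A u = w :=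
  ⟨fun ⟨_, h⟩ => ext_inner_right ℝ fun v => h ⟨v, trivial⟩, fun h => ⟨trivial, fun v => by
    rw [ofBounded_form_apply, h]⟩⟩

theorem isSemigroup_expSemigroup (A : Lp ℝ 2 m →L[ℝ] Lp ℝ 2 m) :
    (ofBounded A).IsSemigroup (expSemigroup A) where
  zero := expSemigroup_zero A
  add s t _ _ := expSemigroup_add A s t
  continuousOn u := fun s _ => (hasDerivAt_expSemigroup A u s).continuousAt.continuousWithinAt
  generator u w := by
    have h : Tendsto (fun t : ℝ => t⁻¹ • (u - expSemigroup A t u)) (𝓝[>] 0) (𝓝 (A u)) := by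
      have h1 := ((hasDerivAt_expSemigroup A u 0).hasDerivWithinAt (s := Set.Ioi 0))
      rw [hasDerivWithinAt_iff_tendsto_slope' Set.self_notMem_Ioi, expSemigroup_zero] at h1
      have h2 := h1.neg
      rw [neg_neg] at h2
      refine h2.congr fun t => ?_
      rw [slope_def_module, expSemigroup_zero, sub_zero, ← smul_neg, neg_sub]
      rfl
    rw [operatorGraph_ofBounded]
    exact ⟨fun hw => hw ▸ h, fun hw => tendsto_nhds_unique h hw⟩

/-- The chosen semigroup and the exponential both solve u' = -Au with the same initial value; the
field is Lipschitz, so right derivatives suffice for uniqueness. -/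
theorem semigroup_ofBounded (A : Lp ℝ 2 m →L[ℝ] Lp ℝ 2 m) {t : ℝ} (ht : 0 ≤ t) :
    (ofBounded A).semigroup t = expSemigroup A t := by
  have h : ∃ T, (ofBounded A).IsSemigroup T := ⟨_, isSemigroup_expSemigroup A⟩
  have hS : (ofBounded A).IsSemigroup (ofBounded A).semigroup := by
    rw [semigroup, dif_pos h]
    exact h.choose_spec
  have key {T : ℝ → Lp ℝ 2 m →L[ℝ] Lp ℝ 2 m} (hT : (ofBounded A).IsSemigroup T)
      (u : Lp ℝ 2 m) (s : ℝ) (hs : 0 ≤ s) :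
      HasDerivWithinAt (fun t => T t u) ((-A) (T s u)) (Set.Ici s) s := by
    have h1 := hT.operatorGraph_apply (operatorGraph_ofBounded.2 (rfl : A u = A u)) hs
    have h2 := hT.hasDerivWithinAt (operatorGraph_ofBounded.2 (rfl : A u = A u)) hs
    rw [operatorGraph_ofBounded] at h1
    rwa [← h1] at h2
  ext1 u
  exact ODE_solution_unique_of_mem_Icc_right (v := fun _ => -A) (s := fun _ => Set.univ)
    (a := 0) (b := t) (fun _ _ => (-A).lipschitz.lipschitzOnWith)
    ((hS.continuousOn u).mono Set.Icc_subset_Ici_self) (fun s hs => key hS u s hs.1)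
    (fun _ _ => trivial)
    (((isSemigroup_expSemigroup A).continuousOn u).mono Set.Icc_subset_Ici_self)
    (fun s hs => key (isSemigroup_expSemigroup A) u s hs.1) (fun _ _ => trivial)
    (by rw [hS.zero, expSemigroup_zero]) ⟨ht, le_rfl⟩

theorem isInvariant_iff {Y : Set X} (hY : MeasurableSet Y) :
    E.IsInvariant Y ↔ ∀ t : ℝ, 0 < t → Commute (indicatorCLM hY) (E.semigroup t) :=
  ⟨fun ⟨_, h⟩ t ht => ContinuousLinearMap.ext fun u => (h t ht u).symm,
    fun h => ⟨hY, fun t ht u => (DFunLike.congr_fun (h t ht).eq u).symm⟩⟩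

/-- A is recovered from its semigroup as the limit of (1 - e^{-tA})/t; conversely whatever commutes
with A commutes with its exponential. -/
theorem isInvariant_ofBounded_iff {A : Lp ℝ 2 m →L[ℝ] Lp ℝ 2 m} {Y : Set X}
    (hY : MeasurableSet Y) : (ofBounded A).IsInvariant Y ↔ Commute (indicatorCLM hY) A := by
  rw [isInvariant_iff hY]
  refine ⟨fun h => ContinuousLinearMap.ext fun u => ?_, fun h t ht => ?_⟩
  · have hlim (u : Lp ℝ 2 m) := ((isSemigroup_expSemigroup A).generator u _).1
      (operatorGraph_ofBounded.2 rfl)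
    refine tendsto_nhds_unique
      ((((indicatorCLM hY).continuous.tendsto _).comp (hlim u)).congr' ?_)
      (hlim (indicatorCLM hY u))
    filter_upwards [self_mem_nhdsWithin] with t ht
    have h1 := DFunLike.congr_fun (h t ht).eq u
    rw [semigroup_ofBounded A (le_of_lt ht)] at h1
    change indicatorCLM hY (expSemigroup A t u) = expSemigroup A t (indicatorCLM hY u) at h1
    simp [h1]
  · rw [semigroup_ofBounded A ht.le]
    exact commute_expSemigroup h t

theorem isInvariant_ofBounded_smul_sub_iff {S : Lp ℝ 2 m →L[ℝ] Lp ℝ 2 m} {c : ℝ} (hc : c ≠ 0)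
    {Y : Set X} (hY : MeasurableSet Y) :
    (ofBounded (c • (ContinuousLinearMap.id ℝ (Lp ℝ 2 m) - S))).IsInvariant Y ↔
      Commute (indicatorCLM hY) S := by
  rw [isInvariant_ofBounded_iff hY, Commute.smul_right_iff₀ hc]
  refine ⟨fun h => ?_, fun h => (Commute.one_right _).sub_right h⟩
  have h1 := (Commute.one_right (indicatorCLM hY)).sub_right h
  change Commute _ (ContinuousLinearMap.id ℝ (Lp ℝ 2 m) -
    (ContinuousLinearMap.id ℝ (Lp ℝ 2 m) - S)) at h1
  rwa [sub_sub_cancel] at h1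

/-! ### Commutation with the semigroup and with the resolvent. -/

theorem IsDirichletForm.commute_resolvent (hE : E.IsDirichletForm)
    {P : Lp ℝ 2 m →L[ℝ] Lp ℝ 2 m} (h : ∀ t : ℝ, 0 < t → Commute P (E.semigroup t)) {β : ℝ}
    (hβ : 0 < β) : Commute P (E.resolvent β) := by
  ext1 f
  refine (hE.resolvent_eq hβ ?_).symm
  have h1 := (hE.isSemigroup_semigroup.generator _ _).1 (hE.operatorGraph_resolvent hβ f)
  change E.OperatorGraph (P (E.resolvent β f)) (P f - β • P (E.resolvent β f))
  rw [← map_smul, ← map_sub, hE.isSemigroup_semigroup.generator]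
  refine ((P.continuous.tendsto _).comp h1).congr' ?_
  filter_upwards [self_mem_nhdsWithin] with t ht
  have h2 : P (E.semigroup t (E.resolvent β f)) = E.semigroup t (P (E.resolvent β f)) :=
    DFunLike.congr_fun (h t ht).eq _
  simp [h2]

theorem IsDirichletForm.commute_semigroup (hE : E.IsDirichletForm)
    {P : Lp ℝ 2 m →L[ℝ] Lp ℝ 2 m} {β : ℝ} (hβ : 0 < β) (h : Commute P (E.resolvent β)) {t : ℝ}
    (ht : 0 ≤ t) : Commute P (E.semigroup t) := by
  have hT := hE.isSemigroup_semigroup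
  -- Every graph point satisfies u = K_β(w + βu), so P moves through K_β.
  have hP {u w : Lp ℝ 2 m} (hu : E.OperatorGraph u w) : E.OperatorGraph (P u) (P w) := by
    have h1 : E.resolvent β (w + β • u) = u := hE.resolvent_eq hβ (by simpa using hu)
    have h2 := hE.operatorGraph_resolvent hβ (P (w + β • u))
    have h3 : P (E.resolvent β (w + β • u)) = E.resolvent β (P (w + β • u)) :=
      DFunLike.congr_fun h.eq _
    rw [← h3, h1] at h2
    simpa using h2
  refine DFunLike.coe_injective (Continuous.ext_on hE.isMaxAccretive.dense
    (P * E.semigroup t).continuous (E.semigroup t * P).continuous ?_)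
  rintro u ⟨w, hu⟩
  -- The difference of the two curves has derivative -g, where g is L applied to that difference;
  -- accretivity of L gives the sign.
  refine sub_eq_zero.1 (eq_zero_of_dissipative
    (f := fun t => P (E.semigroup t u) - E.semigroup t (P u))
    (g := fun t => P (E.semigroup t w) - E.semigroup t (P w)) ?_ ?_ (fun s hs => ?_)
    (fun s hs => ?_) ht)
  · exact (P.continuous.comp_continuousOn (hT.continuousOn u)).sub (hT.continuousOn (P u))
  · simp [hT.zero]
  · have h1 := P.hasFDerivAt.comp_hasDerivWithinAt s (hT.hasDerivWithinAt hu hs)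
    refine (h1.sub (hT.hasDerivWithinAt (hP hu) hs)).congr_deriv ?_
    rw [map_neg]
    abel
  · have h1 : E.OperatorGraph (P (E.semigroup s u)) (P (E.semigroup s w)) :=
      hP (hT.operatorGraph_apply hu hs)
    have h2 := hT.operatorGraph_apply (hP hu) hs
    rw [← mem_operatorSubmodule] at h1 h2
    exact hE.isMaxAccretive.accretive _ _ (E.operatorSubmodule.sub_mem h1 h2)

end L2Form

theorem mainTheorem7 {X : Type*} [MeasurableSpace X] (m : Measure X)
    (E : L2Form m) (hE : E.IsDirichletForm) (Y : Set X) (hY : MeasurableSet Y) :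
    List.TFAE
      [∀ t : ℝ, 0 < t → (E.timeApprox t).IsInvariant Y,
       ∀ β : ℝ, 0 < β → (E.yosidaApprox β).IsInvariant Y,
       E.IsInvariant Y] := by
  have hb {β : ℝ} (hβ : 0 < β) :
      (E.yosidaApprox β).IsInvariant Y ↔ Commute (indicatorCLM hY) (E.resolvent β) :=
    (L2Form.isInvariant_ofBounded_smul_sub_iff hβ.ne' hY).trans
      (Commute.smul_right_iff₀ hβ.ne')
  tfae_have 1 ↔ 3 := by
    rw [L2Form.isInvariant_iff hY]
    exact forall₂_congr fun t ht =>
      L2Form.isInvariant_ofBounded_smul_sub_iff (inv_ne_zero ht.ne') hY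
  -- Commutation with the single resolvent K_1 already suffices.
  tfae_have 2 → 3 := fun h => (L2Form.isInvariant_iff hY).2 fun t ht =>
    hE.commute_semigroup one_pos ((hb one_pos).1 (h 1 one_pos)) ht.le
  tfae_have 3 → 2 := fun h β hβ =>
    (hb hβ).2 (hE.commute_resolvent ((L2Form.isInvariant_iff hY).1 h) hβ)
  tfae_finish
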